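/- There is a universal constant $C>0$ such that the following holds. Let $H=\sum_{R\in\mathcal E}h_R$ be a $k$-local Hamiltonian on $n$ qubits: $\mathcal E$ is a set of hyperedges $R\subseteq[n]$ with $|R|\le k$, and each $h_R$ is Hermitian, acts only on the qubits in $R$ and has spectral norm $\|h_R\|\le 1$. Let $d=\max_i|\{R\in\mathcal E: i\in R\}|$ be the maximum degree. Let $W$ be the unitary of a quantum circuit on $n$ qubits with maximum lightcone size $\ell$, where an input qubit $j$ and an output qubit $i$ are causally connected if a path along the wires and through the gates of the circuit leads from $j$ to $i$, the lightcone of an input (resp. output) qubit is the set of all output (resp. input) qubits causally connected to it, and $\ell$ is the largest size of a lightcone. Put $|\psi\rangle=W|0^n\rangle$ (possibly entangled), $F=\sum_{j=1}^n W\,|1\rangle\langle 1|_j\,W^\dagger$ and $A=i[H,F]$. Then there is a real $\theta$ such that, with $U_D=e^{-i\theta A}$, the state $|\psi_D\rangle=U_D|\psi\rangle$ satisfies $$\langle\psi_D|H|\psi_D\rangle\;\le\;\langle\psi|H|\psi\rangle-C\,\frac{\mathrm{Var}(H)^2}{k^4\,\ell^{10}\,d^2\,|\mathcal E|},\qquad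 \mathrm{Var}(H)=\langle\psi|H^2|\psi\rangle-\langle\psi|H|\psi\rangle^2,$$ where the quotient is read as $0$ if its denominator vanishes (in which case $\mathrm{Var}(H)=0$). -/

import Mathlib

open scoped Matrix Matrix.Norms.L2Operator

noncomputable section

/-- Computational basis labels of `n` qubits (bit strings). -/
abbrev Bits (n : ℕ) : Type := Fin n → Fin 2

/-- State vectors of `n` qubits, in the computational basis. -/
abbrev StateVec (n : ℕ) : Type := Bits n → ℂ

/-- Operators on `n` qubits, as matrices in the computational basis.
The norm `‖O‖` of an operator is the spectral norm (operator norm for the Euclidean norm). -/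
abbrev QOp (n : ℕ) : Type := Matrix (Bits n) (Bits n) ℂ

/-- `O` acts only on the qubits in `R`: it has the form `M ⊗ 1`, with `M` an operator on the
qubits in `R` and `1` the identity on the remaining qubits. -/
def QOp.ActsOn {n : ℕ} (O : QOp n) (R : Finset (Fin n)) : Prop :=
  ∃ M : Matrix (R → Fin 2) (R → Fin 2) ℂ, ∀ x y : Bits n,
    O x y = open Classical in
      if ∀ i, i ∉ R → x i = y i then M (fun i => x i) (fun i => y i) else 0

/-- The all-zero basis state `|0…0⟩`. -/
def zeroState (n : ℕ) : StateVec n := Pi.single (fun _ => 0) 1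

/-- The expectation value `⟨ψ|O|ψ⟩` of a Hermitian operator `O`. -/
def expectation {n : ℕ} (ψ : StateVec n) (O : QOp n) : ℝ :=
  (star ψ ⬝ᵥ (O *ᵥ ψ)).re

/-- The variance `⟨ψ|O²|ψ⟩ - ⟨ψ|O|ψ⟩²`. -/
def variance {n : ℕ} (ψ : StateVec n) (O : QOp n) : ℝ :=
  expectation ψ (O * O) - expectation ψ O ^ 2

/-- A `k`-local Hamiltonian on `n` qubits: a hypergraph with vertex set `Fin n` whose hyperedges
contain at most `k` qubits, and for every hyperedge `R` a Hermitian term acting on the qubits in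
`R`, of spectral norm at most `1`. -/
structure LocalHamiltonian (n k : ℕ) where
  edges : Finset (Finset (Fin n))
  term : Finset (Fin n) → QOp n
  card_le : ∀ R ∈ edges, R.card ≤ k
  isHermitian : ∀ R ∈ edges, (term R).IsHermitian
  actsOn : ∀ R ∈ edges, (term R).ActsOn R
  norm_le_one : ∀ R ∈ edges, ‖term R‖ ≤ 1

namespace LocalHamiltonian

variable {n k : ℕ} (H : LocalHamiltonian n k)

/-- The operator `∑_R h_R`. -/
def op : QOp n := ∑ R ∈ H.edges, H.term R

/-- The number of hyperedges that contain the qubit `i`. -/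
def degree (i : Fin n) : ℕ := (H.edges.filter (fun R => i ∈ R)).card

/-- The maximum degree `d` of the hypergraph. -/
def maxDegree : ℕ := Finset.univ.sup H.degree

end LocalHamiltonian

/-- A quantum gate on `n` qubits: a unitary acting on the qubits of a set `supp`. -/
structure Gate (n : ℕ) where
  supp : Finset (Fin n)
  mat : QOp n
  unitary : mat ∈ Matrix.unitaryGroup (Bits n) ℂ
  actsOn : mat.ActsOn supp

/-- A quantum circuit: a list of gates, the head of the list being applied first. -/
abbrev Circuit (n : ℕ) : Type := List (Gate n)

namespace Circuit

variable {n : ℕ}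

/-- The unitary implemented by a circuit. -/
def toOp : Circuit n → QOp n
  | [] => 1
  | g :: c => toOp c * g.mat

/-- `c.Connects j i`: the input qubit `j` and the output qubit `i` are causally connected, that is,
there is a path through the circuit from `j` to `i` which follows the qubit wires and may change
from one wire to another at a gate that acts on both. -/
def Connects : Circuit n → Fin n → Fin n → Prop
  | [], j, i => j = i
  | g :: c, j, i => ∃ m, (j = m ∨ (j ∈ g.supp ∧ m ∈ g.supp)) ∧ Connects c m i

open Classical in
/-- The (future) lightcone of the input qubit `j`: all output qubits causally connected to it. -/
def lightcone (c : Circuit n) (j : Fin n) : Finset (Fin n) :=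
  Finset.univ.filter (fun i => c.Connects j i)

open Classical in
/-- The (past) lightcone of the output qubit `i`: all input qubits causally connected to it. -/
def pastLightcone (c : Circuit n) (i : Fin n) : Finset (Fin n) :=
  Finset.univ.filter (fun j => c.Connects j i)

/-- The maximum size of a lightcone, over all input qubits and all output qubits. -/
def maxLightcone (c : Circuit n) : ℕ :=
  Finset.univ.sup (fun j => max (c.lightcone j).card (c.pastLightcone j).card)

end Circuit

/-- The projector `|1⟩⟨1|_j` on the excited state of qubit `j`. -/
def excitedProj {n : ℕ} (j : Fin n) : QOp n :=
  Matrix.diagonal (fun x => if x j = 1 then 1 else 0)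

/-- `F = ∑_j W |1⟩⟨1|_j W†`. -/
def opF {n : ℕ} (W : QOp n) : QOp n := ∑ j, W * excitedProj j * Wᴴ

/-- `A = i [H, F]`. -/
def opA {n : ℕ} (H W : QOp n) : QOp n :=
  Complex.I • (H * opF W - opF W * H)

/-- `U_D = exp (-i θ A)`. -/
def deepUnitary {n : ℕ} (H W : QOp n) (θ : ℝ) : QOp n :=
  NormedSpace.exp ((-(Complex.I * (θ : ℂ))) • opA H W)

end

/-!
Let `V` be the variance of `H` in `ψ = W|0⟩`, and let `f θ` be the energy of `e^{-iθA} ψ`. The energy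
decreases by at least `V² / (96 D)` for a suitable `θ`, where `D` is the denominator in the
statement, because `f` starts with slope at most `-2V` and has second derivative at most `192 D`.

* Slope. `F` is the conjugate by `W` of the operator that counts ones, so `F ψ = 0`, and `F ≥ 1` on
  the orthogonal complement of `ψ`. By the first fact, `f' 0 = ⟨i[A, H]⟩ = -2 ⟨H F H⟩`
  (`expectation_lie_opA`); by the second, `⟨H F H⟩ ≥ ⟨H (1 - |ψ⟩⟨ψ|) H⟩ = V`
  (`variance_le_expectation_opF`).
* Curvature. `f'' θ` is an expectation value of `-[A, [A, H]]` (`expectation_flow_le`), so the norm of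
  this double commutator bounds it. `W |1⟩⟨1|_j W†` acts on the lightcone of `j` only
  (`Circuit.actsOn_conj_excitedProj`), hence `A` is a sum of terms of norm at most `2`, one for each
  pair of a hyperedge and a lightcone that meet, and operators with disjoint supports commute
  (`QOp.ActsOn.commute`). At most `s d ℓ (k + ℓ)` terms of `A` meet a given set of `s` qubits
  (`card_overlapPairs_meeting_le`). Applied with `s = k`, the support size of a term of `H`, and then
  with `s = 2k + ℓ`, that of its commutator with a term of `A`, this gives
  `‖[A, [A, H]]‖ ≤ 192 D` (`norm_lie_lie_op_le`).
-/

/-! ### Operators supported on a set of qubits -/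

namespace QOp

variable {n : ℕ}

/-- Addition of bit strings is bitwise xor. An operator has the form `M ⊗ 1` on `R` iff its matrix
entries vanish unless row and column agree off `R`, and do not change when the same bits off `R`
are flipped in row and column. -/
theorem actsOn_iff {O : QOp n} {R : Finset (Fin n)} :
    O.ActsOn R ↔ (∀ x y, O x y ≠ 0 → ∀ i, i ∉ R → x i = y i) ∧
      ∀ t : Bits n, (∀ i ∈ R, t i = 0) → ∀ x y, O (x + t) (y + t) = O x y := by
  classical
  constructor
  · rintro ⟨M, hM⟩
    refine ⟨fun x y h => ?_, fun t ht x y => ?_⟩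
    · by_contra hxy
      exact h (by rw [hM, if_neg hxy])
    · have hx : ∀ z : Bits n, (fun i : R => (z + t) i) = fun i : R => z i := by
        intro z
        funext i
        simp [ht i i.2]
      rw [hM, hM, hx x, hx y]
      simp only [Pi.add_apply, add_left_inj]
  · rintro ⟨h0, ht⟩
    let e : (R → Fin 2) → Bits n := fun a i => if h : i ∈ R then a ⟨i, h⟩ else 0
    refine ⟨fun a b => O (e a) (e b), fun x y => ?_⟩
    split_ifs with hxy
    · let t : Bits n := fun i => if i ∈ R then 0 else x i
      have hx : e (fun i => x i) + t = x := by
        funext i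
        by_cases hi : i ∈ R <;> simp [e, t, hi]
      have hy : e (fun i => y i) + t = y := by
        funext i
        by_cases hi : i ∈ R <;> simp [e, t, hi, hxy i]
      have := ht t (fun i hi => by simp [t, hi]) (e fun i => x i) (e fun i => y i)
      rwa [hx, hy] at this
    · by_contra h
      exact hxy (h0 x y h)

theorem ActsOn.mono {O : QOp n} {R S : Finset (Fin n)} (h : O.ActsOn R) (hRS : R ⊆ S) :
    O.ActsOn S := by
  rw [actsOn_iff] at *
  exact ⟨fun x y hxy i hi => h.1 x y hxy i fun hR => hi (hRS hR),
    fun t ht => h.2 t fun i hi => ht i (hRS hi)⟩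

theorem ActsOn.mul {O P : QOp n} {R : Finset (Fin n)} (hO : O.ActsOn R) (hP : P.ActsOn R) :
    QOp.ActsOn (O * P) R := by
  rw [actsOn_iff] at *
  refine ⟨fun x y hxy i hi => ?_, fun t ht x y => ?_⟩
  · rw [Matrix.mul_apply] at hxy
    obtain ⟨z, -, hz⟩ := Finset.exists_ne_zero_of_sum_ne_zero hxy
    exact (hO.1 x z (left_ne_zero_of_mul hz) i hi).trans (hP.1 z y (right_ne_zero_of_mul hz) i hi)
  · rw [Matrix.mul_apply, Matrix.mul_apply]
    refine (Fintype.sum_equiv (Equiv.addRight t) _ _ fun z => ?_).symm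
    simp only [Equiv.coe_addRight, hO.2 t ht, hP.2 t ht]

theorem ActsOn.sub {O P : QOp n} {R : Finset (Fin n)} (hO : O.ActsOn R) (hP : P.ActsOn R) :
    (O - P).ActsOn R := by
  rw [actsOn_iff] at *
  refine ⟨fun x y hxy i hi => ?_, fun t ht x y => ?_⟩
  · by_contra h
    have h1 : O x y = 0 := by_contra fun h' => h (hO.1 x y h' i hi)
    have h2 : P x y = 0 := by_contra fun h' => h (hP.1 x y h' i hi)
    simp [h1, h2] at hxy
  · rw [Matrix.sub_apply, Matrix.sub_apply, hO.2 t ht, hP.2 t ht]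

theorem ActsOn.smul {O : QOp n} {R : Finset (Fin n)} (hO : O.ActsOn R) (c : ℂ) :
    (c • O).ActsOn R := by
  rw [actsOn_iff] at *
  refine ⟨fun x y hxy => hO.1 x y fun h => hxy (by simp [h]), fun t ht x y => ?_⟩
  rw [Matrix.smul_apply, Matrix.smul_apply, hO.2 t ht]

theorem ActsOn.conjTranspose {O : QOp n} {R : Finset (Fin n)} (hO : O.ActsOn R) :
    QOp.ActsOn Oᴴ R := by
  rw [actsOn_iff] at *
  refine ⟨fun x y hxy i hi => (hO.1 y x (fun h => hxy (by simp [h])) i hi).symm,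
    fun t ht x y => ?_⟩
  rw [Matrix.conjTranspose_apply, Matrix.conjTranspose_apply, hO.2 t ht]

theorem ActsOn.lie {O P : QOp n} {R S : Finset (Fin n)} (hO : O.ActsOn R) (hP : P.ActsOn S) :
    (⁅O, P⁆ : QOp n).ActsOn (R ∪ S) := by
  have hO' := hO.mono (Finset.subset_union_left (s₂ := S))
  have hP' := hP.mono (Finset.subset_union_right (s₁ := R))
  exact (hO'.mul hP').sub (hP'.mul hO')

theorem ActsOn.commute {O P : QOp n} {R S : Finset (Fin n)} (hO : O.ActsOn R) (hP : P.ActsOn S)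
    (h : Disjoint R S) : O * P = P * O := by
  rw [actsOn_iff] at hO hP
  ext x y
  rw [Matrix.mul_apply, Matrix.mul_apply]
  -- A path `x → z → y` which changes the bits in `R` first corresponds to the path
  -- `x → x + y - z → y` which changes the bits in `S` first.
  refine Fintype.sum_equiv (Equiv.subLeft (x + y)) _ _ fun z => ?_
  simp only [Equiv.subLeft_apply]
  set w : Bits n := x + y - z with hw
  by_cases hxz : ∀ i, i ∉ R → x i = z i
  · by_cases hzy : ∀ i, i ∉ S → z i = y i
    · have h1 : O x z = O w y := by
        have := hO.2 (y - z) (fun i hi => by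
          simp [hzy i (Finset.disjoint_left.1 h hi)]) x z
        rw [← this, hw]
        congr 1 <;> abel
      have h2 : P z y = P x w := by
        have := hP.2 (x - z) (fun i hi => by
          simp [hxz i (Finset.disjoint_right.1 h hi)]) z y
        rw [← this, hw]
        congr 1 <;> abel
      rw [h1, h2, mul_comm]
    · have h1 : P z y = 0 := by_contra fun h' => hzy (hP.1 _ _ h')
      have h2 : P x w = 0 := by
        refine by_contra fun h' => hzy fun i hi => ?_
        have := hP.1 _ _ h' i hi
        simp only [hw, Pi.add_apply, Pi.sub_apply] at this
        exact add_left_cancel (eq_sub_iff_add_eq.1 this)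
      rw [h1, h2, mul_zero, zero_mul]
  · have h1 : O x z = 0 := by_contra fun h' => hxz (hO.1 _ _ h')
    have h2 : O w y = 0 := by
      refine by_contra fun h' => hxz fun i hi => ?_
      have := hO.1 _ _ h' i hi
      simp only [hw, Pi.add_apply, Pi.sub_apply] at this
      exact add_right_cancel ((sub_eq_iff_eq_add.1 this).trans (add_comm _ _))
    rw [h1, h2, mul_zero, zero_mul]

theorem actsOn_excitedProj (j : Fin n) : (excitedProj j).ActsOn {j} := by
  rw [actsOn_iff]
  refine ⟨fun x y h i _ => ?_, fun t ht x y => ?_⟩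
  · by_contra hxy
    exact h (Matrix.diagonal_apply_ne _ fun h' => hxy (congrFun h' i))
  · simp [excitedProj, Matrix.diagonal_apply, ht j]

end QOp

/-! ### Lightcones -/

namespace Circuit

variable {n : ℕ}

theorem toOp_mem_unitaryGroup (c : Circuit n) : c.toOp ∈ Matrix.unitaryGroup (Bits n) ℂ := by
  induction c with
  | nil => exact one_mem _
  | cons g c ih => exact mul_mem ih g.unitary

/-- In the Heisenberg picture a circuit spreads an operator at most over the lightcones of the
qubits it acts on: a gate that does not touch the support cancels. -/
theorem actsOn_conj (c : Circuit n) {O : QOp n} {S T : Finset (Fin n)} (hO : O.ActsOn S)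
    (hT : ∀ j ∈ S, ∀ i, c.Connects j i → i ∈ T) : QOp.ActsOn (c.toOp * O * c.toOpᴴ) T := by
  classical
  induction c generalizing O S with
  | nil => simpa [toOp] using hO.mono fun j hj => hT j hj j rfl
  | cons g c ih =>
    have hconj : toOp (g :: c) * O * (toOp (g :: c))ᴴ
        = toOp c * (g.mat * O * g.matᴴ) * (toOp c)ᴴ := by
      simp only [toOp, Matrix.conjTranspose_mul, Matrix.mul_assoc]
    rw [hconj]
    by_cases hd : Disjoint g.supp S
    · have hg : g.mat * O * g.matᴴ = O := by
        rw [g.actsOn.commute hO hd, Matrix.mul_assoc]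
        have : g.mat * g.matᴴ = 1 := Matrix.mem_unitaryGroup_iff.1 g.unitary
        rw [this, Matrix.mul_one]
      rw [hg]
      exact ih hO fun j hj i hji => hT j hj i ⟨j, Or.inl rfl, hji⟩
    · have hg := g.actsOn.mono (Finset.subset_union_left (s₂ := S))
      refine ih ((hg.mul (hO.mono Finset.subset_union_right)).mul hg.conjTranspose)
        fun m hm i hmi => ?_
      obtain ⟨j, hjg, hjS⟩ := Finset.not_disjoint_iff.1 hd
      rcases Finset.mem_union.1 hm with hm | hm
      · exact hT j hjS i ⟨m, Or.inr ⟨hjg, hm⟩, hmi⟩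
      · exact hT m hm i ⟨m, Or.inl rfl, hmi⟩

theorem actsOn_conj_excitedProj (c : Circuit n) (j : Fin n) :
    
    QOp.ActsOn (c.toOp * excitedProj j * c.toOpᴴ) (c.lightcone j) :=
  c.actsOn_conj (QOp.actsOn_excitedProj j) fun m hm i h => by
    rw [Finset.mem_singleton.1 hm] at h
    simpa [lightcone] using h

theorem card_lightcone_le (c : Circuit n) (j : Fin n) : (c.lightcone j).card ≤ c.maxLightcone :=
  (le_max_left _ _).trans
    (Finset.le_sup (f := fun j => max (c.lightcone j).card (c.pastLightcone j).card)
      (Finset.mem_univ j))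

theorem card_pastLightcone_le (c : Circuit n) (j : Fin n) :
    (c.pastLightcone j).card ≤ c.maxLightcone :=
  (le_max_right _ _).trans
    (Finset.le_sup (f := fun j => max (c.lightcone j).card (c.pastLightcone j).card)
      (Finset.mem_univ j))

theorem mem_lightcone_iff {c : Circuit n} {i j : Fin n} :
    i ∈ c.lightcone j ↔ j ∈ c.pastLightcone i := by
  simp [lightcone, pastLightcone]

end Circuit

/-! ### Counting overlapping supports -/

section Counting

variable {n k : ℕ}

open Classical in
/-- The pairs of a hyperedge `R` and a qubit `j` for which `h_R` need not commute with
`W |1⟩⟨1|_j W†`, because `R` meets the lightcone of `j`. -/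
noncomputable def overlapPairs (H : LocalHamiltonian n k) (W : Circuit n) :
    Finset (Finset (Fin n) × Fin n) :=
  (H.edges ×ˢ Finset.univ).filter fun p => ¬Disjoint p.1 (W.lightcone p.2)

theorem LocalHamiltonian.degree_le (H : LocalHamiltonian n k) (i : Fin n) :
    H.degree i ≤ H.maxDegree :=
  Finset.le_sup (Finset.mem_univ i)

open Classical in
/-- An overlapping pair `(R, j)` meets `S` either through `R`, and then `j` is in the past lightcone
of a qubit of `R`, or through the lightcone of `j`, and then `R` contains a qubit of that
lightcone. -/
theorem card_overlapPairs_meeting_le (H : LocalHamiltonian n k) (W : Circuit n)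
    (S : Finset (Fin n)) :
    ((overlapPairs H W).filter fun p => ¬Disjoint (p.1 ∪ W.lightcone p.2) S).card ≤
      S.card * (H.maxDegree * (k * W.maxLightcone)
        + W.maxLightcone * (W.maxLightcone * H.maxDegree)) := by
  let E : Fin n → Finset (Finset (Fin n)) := fun i => H.edges.filter fun R => i ∈ R
  let G : Fin n → Finset (Finset (Fin n) × Fin n) := fun i =>
    ((E i).biUnion fun R => R.biUnion fun m => (W.pastLightcone m).image fun j => (R, j)) ∪
    (W.pastLightcone i).biUnion fun j => (W.lightcone j).biUnion fun m =>
      (E m).image fun R => (R, j)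
  have hE : ∀ i, (E i).card ≤ H.maxDegree := H.degree_le
  have hsub : ((overlapPairs H W).filter fun p => ¬Disjoint (p.1 ∪ W.lightcone p.2) S) ⊆
      S.biUnion G := by
    rintro ⟨R, j⟩ hp
    simp only [overlapPairs, Finset.mem_filter, Finset.mem_product, Finset.mem_univ, and_true] at hp
    obtain ⟨⟨hR, hRj⟩, hS⟩ := hp
    obtain ⟨m, hmR, hmj⟩ := Finset.not_disjoint_iff.1 hRj
    obtain ⟨i, hi, hiS⟩ := Finset.not_disjoint_iff.1 hS
    refine Finset.mem_biUnion.2 ⟨i, hiS, Finset.mem_union.2 ?_⟩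
    rcases Finset.mem_union.1 hi with hi | hi
    · exact Or.inl (Finset.mem_biUnion.2 ⟨R, Finset.mem_filter.2 ⟨hR, hi⟩, Finset.mem_biUnion.2
        ⟨m, hmR, Finset.mem_image.2 ⟨j, Circuit.mem_lightcone_iff.1 hmj, rfl⟩⟩⟩)
    · exact Or.inr (Finset.mem_biUnion.2 ⟨j, Circuit.mem_lightcone_iff.1 hi, Finset.mem_biUnion.2
        ⟨m, hmj, Finset.mem_image.2 ⟨R, Finset.mem_filter.2 ⟨hR, hmR⟩, rfl⟩⟩⟩)
  refine (Finset.card_le_card hsub).trans (Finset.card_biUnion_le_card_mul _ _ _ fun i _ => ?_)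
  refine (Finset.card_union_le _ _).trans (add_le_add ?_ ?_)
  · refine (Finset.card_biUnion_le_card_mul _ _ (k * W.maxLightcone) fun R hR => ?_).trans
      (Nat.mul_le_mul_right _ (hE i))
    refine (Finset.card_biUnion_le_card_mul _ _ W.maxLightcone fun m _ => ?_).trans
      (Nat.mul_le_mul_right _ (H.card_le R (Finset.mem_filter.1 hR).1))
    exact Finset.card_image_le.trans (W.card_pastLightcone_le m)
  · refine (Finset.card_biUnion_le_card_mul _ _ (W.maxLightcone * H.maxDegree)
      fun j _ => ?_).trans (Nat.mul_le_mul_right _ (W.card_pastLightcone_le i))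
    refine (Finset.card_biUnion_le_card_mul _ _ H.maxDegree fun m _ => ?_).trans
      (Nat.mul_le_mul_right _ (W.card_lightcone_le j))
    exact Finset.card_image_le.trans (hE m)

end Counting

/-! ### The norm of the double commutator -/

section DoubleCommutator

variable {n k : ℕ}

theorem norm_lie_le (X Y : QOp n) : ‖(⁅X, Y⁆ : QOp n)‖ ≤ 2 * ‖X‖ * ‖Y‖ := by
  have h1 := norm_mul_le X Y
  have h2 := norm_mul_le Y X
  have h3 := norm_sub_le (X * Y) (Y * X)
  rw [Ring.lie_def]
  nlinarith

theorem commutator_sum_left {ι : Type*} (s : Finset ι) (f : ι → QOp n) (X : QOp n) :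
    (⁅∑ a ∈ s, f a, X⁆ : QOp n) = ∑ a ∈ s, ⁅f a, X⁆ := by
  simp only [Ring.lie_def, Finset.sum_mul, Finset.mul_sum, Finset.sum_sub_distrib]

theorem commutator_sum_right {ι : Type*} (s : Finset ι) (f : ι → QOp n) (X : QOp n) :
    (⁅X, ∑ a ∈ s, f a⁆ : QOp n) = ∑ a ∈ s, ⁅X, f a⁆ := by
  simp only [Ring.lie_def, Finset.sum_mul, Finset.mul_sum, Finset.sum_sub_distrib]

theorem norm_excitedProj_le (j : Fin n) : ‖(excitedProj j : QOp n)‖ ≤ 1 := by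
  rw [excitedProj, Matrix.l2_opNorm_diagonal, pi_norm_le_iff_of_nonneg zero_le_one]
  intro x
  split_ifs <;> simp

theorem norm_conj_excitedProj_le {W : QOp n} (hW : W ∈ Matrix.unitaryGroup (Bits n) ℂ)
    (j : Fin n) : ‖(W * excitedProj j * Wᴴ : QOp n)‖ ≤ 1 := by
  have h1 : ‖W‖ = 1 := CStarRing.norm_of_mem_unitary hW
  have h2 : ‖Wᴴ‖ = 1 := by rw [Matrix.l2_opNorm_conjTranspose, h1]
  calc ‖(W * excitedProj j * Wᴴ : QOp n)‖
      ≤ ‖W‖ * ‖(excitedProj j : QOp n)‖ * ‖Wᴴ‖ :=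
        (norm_mul_le _ _).trans (mul_le_mul_of_nonneg_right (norm_mul_le _ _) (norm_nonneg _))
    _ ≤ 1 := by rw [h1, h2, one_mul, mul_one]; exact norm_excitedProj_le j

/-- The contribution `i [h_R, W |1⟩⟨1|_j W†]` of a pair `(R, j)` to `A`. -/
noncomputable def pairTerm (H : LocalHamiltonian n k) (W : Circuit n) (p : Finset (Fin n) × Fin n) :
    QOp n :=
  Complex.I • ⁅H.term p.1, W.toOp * excitedProj p.2 * W.toOpᴴ⁆

variable (H : LocalHamiltonian n k) (W : Circuit n)

theorem mem_edges_of_mem_overlapPairs {H : LocalHamiltonian n k} {W : Circuit n}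
    {p : Finset (Fin n) × Fin n} (hp : p ∈ overlapPairs H W) : p.1 ∈ H.edges := by
  classical
  exact (Finset.mem_product.1 (Finset.mem_filter.1 hp).1).1

theorem norm_pairTerm_le {p : Finset (Fin n) × Fin n} (hp : p ∈ overlapPairs H W) :
    ‖pairTerm H W p‖ ≤ 2 := by
  have h1 := H.norm_le_one _ (mem_edges_of_mem_overlapPairs hp)
  have h2 := norm_conj_excitedProj_le W.toOp_mem_unitaryGroup p.2
  rw [pairTerm, norm_smul, Complex.norm_I, one_mul]
  refine (norm_lie_le _ _).trans ?_
  nlinarith [norm_nonneg (H.term p.1)]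

theorem actsOn_pairTerm {p : Finset (Fin n) × Fin n} (hp : p ∈ overlapPairs H W) :
    (pairTerm H W p).ActsOn (p.1 ∪ W.lightcone p.2) :=
  ((H.actsOn _ (mem_edges_of_mem_overlapPairs hp)).lie (W.actsOn_conj_excitedProj p.2)).smul _

/-- The pairs that do not overlap drop out of `A`. -/
theorem opA_eq_sum_pairTerm :
    opA H.op W.toOp = ∑ p ∈ overlapPairs H W, pairTerm H W p := by
  classical
  have h : opA H.op W.toOp = ∑ p ∈ H.edges ×ˢ Finset.univ, pairTerm H W p := by
    rw [opA, ← Ring.lie_def, opF, LocalHamiltonian.op, commutator_sum_left, Finset.sum_product,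
      Finset.smul_sum]
    refine Finset.sum_congr rfl fun R _ => ?_
    rw [commutator_sum_right, Finset.smul_sum]
    rfl
  rw [h, overlapPairs, Finset.sum_filter_of_ne]
  intro p hp hne hd
  refine hne ?_
  rw [pairTerm, Ring.lie_def,
    (H.actsOn _ (Finset.mem_product.1 hp).1).commute (W.actsOn_conj_excitedProj p.2) hd, sub_self,
    smul_zero]

theorem lie_opA_eq_sum
    {X : QOp n} {S : Finset (Fin n)} (hX : X.ActsOn S) :
    (⁅opA H.op W.toOp, X⁆ : QOp n) = open Classical in
      ∑ p ∈ (overlapPairs H W).filter fun p => ¬Disjoint (p.1 ∪ W.lightcone p.2) S,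
        ⁅pairTerm H W p, X⁆ := by
  classical
  rw [opA_eq_sum_pairTerm, commutator_sum_left, Finset.sum_filter_of_ne]
  intro p hp hne hd
  exact hne (by rw [Ring.lie_def, (actsOn_pairTerm H W hp).commute hX hd, sub_self])

theorem card_meeting_le {S : Finset (Fin n)} {s : ℕ} (hS : S.card ≤ s) : open Classical in
    ((((overlapPairs H W).filter fun p => ¬Disjoint (p.1 ∪ W.lightcone p.2) S).card : ℕ) : ℝ) ≤
      s * H.maxDegree * W.maxLightcone * (k + W.maxLightcone) := by
  have h := (card_overlapPairs_meeting_le H W S).trans (Nat.mul_le_mul_right _ hS)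
  calc _ ≤ ((s * (H.maxDegree * (k * W.maxLightcone)
        + W.maxLightcone * (W.maxLightcone * H.maxDegree)) : ℕ) : ℝ) := by exact_mod_cast h
    _ = _ := by push_cast; ring

theorem norm_lie_opA_le {X : QOp n} {S : Finset (Fin n)} {s : ℕ} (hX : X.ActsOn S)
    (hS : S.card ≤ s) :
    ‖(⁅opA H.op W.toOp, X⁆ : QOp n)‖ ≤
      s * H.maxDegree * W.maxLightcone * (k + W.maxLightcone) * (4 * ‖X‖) := by
  classical
  rw [lie_opA_eq_sum H W hX]
  refine (norm_sum_le_of_le _ (n := fun _ => 4 * ‖X‖) fun p hp => ?_).trans ?_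
  · have := norm_pairTerm_le H W (Finset.mem_filter.1 hp).1
    refine (norm_lie_le _ _).trans ?_
    nlinarith [norm_nonneg X]
  · rw [Finset.sum_const, nsmul_eq_mul]
    exact mul_le_mul_of_nonneg_right (card_meeting_le H W hS) (by positivity)

/-- The nonzero commutators `[A_p, X]` are supported on at most `2k + ℓ` qubits, so only as many terms
of the outer `A` contribute to each as meet a set of that size. -/
theorem norm_lie_lie_opA_le {X : QOp n} {S : Finset (Fin n)} (hX : X.ActsOn S)
    (hS : S.card ≤ k) (hX1 : ‖X‖ ≤ 1) :
    ‖(⁅opA H.op W.toOp, ⁅opA H.op W.toOp, X⁆⁆ : QOp n)‖ ≤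
      (k * H.maxDegree * W.maxLightcone * (k + W.maxLightcone)) *
      ((2 * k + W.maxLightcone) * H.maxDegree * W.maxLightcone * (k + W.maxLightcone) * 16) := by
  classical
  rw [lie_opA_eq_sum H W hX, commutator_sum_right]
  refine (norm_sum_le_of_le _ (n := fun _ => (2 * k + W.maxLightcone : ℝ) * H.maxDegree *
    W.maxLightcone * (k + W.maxLightcone) * 16) fun p hp => ?_).trans ?_
  · have hp' := (Finset.mem_filter.1 hp).1
    have h2 := norm_pairTerm_le H W hp'
    have h4 : ‖(⁅pairTerm H W p, X⁆ : QOp n)‖ ≤ 4 :=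
      (norm_lie_le _ _).trans (by nlinarith [norm_nonneg X])
    have hcard : (p.1 ∪ W.lightcone p.2 ∪ S).card ≤ 2 * k + W.maxLightcone := by
      have h5 := Finset.card_union_le (p.1 ∪ W.lightcone p.2) S
      have h6 := Finset.card_union_le p.1 (W.lightcone p.2)
      have h7 := H.card_le _ (mem_edges_of_mem_overlapPairs hp')
      have h8 := W.card_lightcone_le p.2
      omega
    refine (norm_lie_opA_le H W ((actsOn_pairTerm H W hp').lie hX) hcard).trans ?_
    push_cast
    exact mul_le_mul_of_nonneg_left (by linarith) (by positivity)
  · rw [Finset.sum_const, nsmul_eq_mul]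
    exact mul_le_mul_of_nonneg_right (card_meeting_le H W hS) (by positivity)

/-- The bound on the second derivative of the energy along the flow generated by `A`. The argument
gives `ℓ ^ 5`; the weaker `ℓ ^ 10` suffices. -/
theorem norm_lie_lie_op_le (hk : 1 ≤ k) (hl : 1 ≤ W.maxLightcone) :
    ‖(⁅opA H.op W.toOp, ⁅opA H.op W.toOp, H.op⁆⁆ : QOp n)‖ ≤
      192 * ((k : ℝ) ^ 4 * (W.maxLightcone : ℝ) ^ 10 * (H.maxDegree : ℝ) ^ 2 * H.edges.card) := by
  have hk' : (1 : ℝ) ≤ k := by exact_mod_cast hk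
  have hl' : (1 : ℝ) ≤ W.maxLightcone := by exact_mod_cast hl
  have hsum : (⁅opA H.op W.toOp, ⁅opA H.op W.toOp, H.op⁆⁆ : QOp n) =
      ∑ R ∈ H.edges, ⁅opA H.op W.toOp, ⁅opA H.op W.toOp, H.term R⁆⁆ := by
    rw [← commutator_sum_right, ← commutator_sum_right]
    rfl
  rw [hsum]
  refine (norm_sum_le_of_le _ fun R hR => norm_lie_lie_opA_le H W (H.actsOn R hR) (H.card_le R hR)
    (H.norm_le_one R hR)).trans ?_
  rw [Finset.sum_const, nsmul_eq_mul]
  -- From here on the estimate is one between real numbers: `k + ℓ ≤ 2kℓ` and `2k + ℓ ≤ 3kℓ`.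
  generalize (W.maxLightcone : ℝ) = l at *
  generalize (H.maxDegree : ℝ) = d at *
  generalize (k : ℝ) = κ at *
  have hkl : κ + l ≤ 2 * (κ * l) := by nlinarith
  have hkl' : 2 * κ + l ≤ 3 * (κ * l) := by nlinarith
  have h5 : l ^ 5 ≤ l ^ 10 := pow_le_pow_right₀ hl' (by norm_num)
  have h0 : 0 ≤ κ * l := by positivity
  calc (H.edges.card : ℝ) * (κ * d * l * (κ + l) * ((2 * κ + l) * d * l * (κ + l) * 16))
      = 16 * H.edges.card * d ^ 2 * κ * l ^ 2 * ((κ + l) * (κ + l) * (2 * κ + l)) := by ring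
    _ ≤ 16 * H.edges.card * d ^ 2 * κ * l ^ 2 *
        ((2 * (κ * l)) * (2 * (κ * l)) * (3 * (κ * l))) := by gcongr
    _ = 192 * κ ^ 4 * d ^ 2 * H.edges.card * l ^ 5 := by ring
    _ ≤ 192 * κ ^ 4 * d ^ 2 * H.edges.card * l ^ 10 := by gcongr
    _ = _ := by ring

end DoubleCommutator

/-! ### The energy along a one-parameter unitary group -/

section Flow

variable {n : ℕ}

theorem star_mulVec_dotProduct (U X : QOp n) (ψ : StateVec n) :
    star (U *ᵥ ψ) ⬝ᵥ (X *ᵥ (U *ᵥ ψ)) = star ψ ⬝ᵥ ((Uᴴ * X * U) *ᵥ ψ) := by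
  rw [Matrix.star_mulVec, ← Matrix.dotProduct_mulVec, Matrix.mulVec_mulVec, Matrix.mulVec_mulVec,
    Matrix.mul_assoc]

theorem expectation_mulVec (U X : QOp n) (ψ : StateVec n) :
    expectation (U *ᵥ ψ) X = expectation ψ (Uᴴ * X * U) := by
  rw [expectation, expectation, star_mulVec_dotProduct]

/-- For a fixed state, the expectation value is a real-linear functional of the operator. -/
noncomputable def expectationCLM (ψ : StateVec n) : QOp n →L[ℝ] ℝ :=
  LinearMap.toContinuousLinearMap
    { toFun := expectation ψ
      map_add' := fun X Y => by simp [expectation, Matrix.add_mulVec]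
      map_smul' := fun c X => by simp [expectation, Matrix.smul_mulVec] }

theorem expectationCLM_apply (ψ : StateVec n) (X : QOp n) :
    expectationCLM ψ X = expectation ψ X := rfl

theorem abs_expectation_le (ψ : StateVec n) (X : QOp n) (hψ : star ψ ⬝ᵥ ψ = 1) :
    |expectation ψ X| ≤ ‖X‖ := by
  have h1 : star ψ ⬝ᵥ (X *ᵥ ψ) = inner ℂ (WithLp.toLp 2 ψ) (WithLp.toLp 2 (X *ᵥ ψ)) := by
    rw [EuclideanSpace.inner_eq_star_dotProduct, dotProduct_comm]
  have h2 : ‖(WithLp.toLp 2 ψ : EuclideanSpace ℂ (Bits n))‖ = 1 := by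
    have h : inner ℂ (WithLp.toLp 2 ψ : EuclideanSpace ℂ (Bits n)) (WithLp.toLp 2 ψ) = 1 := by
      rw [EuclideanSpace.inner_eq_star_dotProduct, dotProduct_comm, hψ]
    have h' := inner_self_eq_norm_sq (𝕜 := ℂ) (WithLp.toLp 2 ψ : EuclideanSpace ℂ (Bits n))
    rw [h, RCLike.one_re] at h'
    exact (pow_eq_one_iff_of_nonneg (norm_nonneg _) two_ne_zero).1 h'.symm
  have h3 := Matrix.l2_opNorm_mulVec X (WithLp.toLp 2 ψ)
  rw [h2, mul_one] at h3
  rw [expectation, h1]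
  refine (Complex.abs_re_le_norm _).trans ((norm_inner_le_norm _ _).trans ?_)
  rw [h2, one_mul]
  exact h3

/-- The unitary `e^{-iθA}`. -/
noncomputable def flow (A : QOp n) (θ : ℝ) : QOp n :=
  NormedSpace.exp (θ • (-(Complex.I • A)))

theorem conjTranspose_flow {A : QOp n} (hA : A.IsHermitian) (θ : ℝ) :
    (flow A θ)ᴴ = NormedSpace.exp (θ • (Complex.I • A)) := by
  rw [flow, ← Matrix.exp_conjTranspose]
  congr 1
  rw [Matrix.conjTranspose_smul, Matrix.conjTranspose_neg, Matrix.conjTranspose_smul, hA.eq]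
  simp

theorem conjTranspose_flow_mul_flow {A : QOp n} (hA : A.IsHermitian) (θ : ℝ) :
    (flow A θ)ᴴ * flow A θ = 1 := by
  let _ : NormedAlgebra ℚ (QOp n) := NormedAlgebra.restrictScalars ℚ ℝ (QOp n)
  rw [conjTranspose_flow hA, flow, smul_neg,
    ← NormedSpace.exp_add_of_commute (Commute.neg_right rfl), add_neg_cancel, NormedSpace.exp_zero]

/-- The Heisenberg equation of motion. -/
theorem hasDerivAt_expectation_flow {A : QOp n} (hA : A.IsHermitian) (ψ : StateVec n) (X : QOp n)
    (θ : ℝ) :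
    HasDerivAt (fun t => expectation (flow A t *ᵥ ψ) X)
      (expectation (flow A θ *ᵥ ψ) (Complex.I • ⁅A, X⁆)) θ := by
  have h1 : HasDerivAt (fun t : ℝ => (flow A t)ᴴ)
      ((flow A θ)ᴴ * (Complex.I • A)) θ := by
    simp only [conjTranspose_flow hA]
    exact hasDerivAt_exp_smul_const (Complex.I • A) θ
  have h2 : HasDerivAt (fun t : ℝ => flow A t) (-(Complex.I • A) * flow A θ) θ :=
    hasDerivAt_exp_smul_const' (-(Complex.I • A)) θ
  have h3 : HasDerivAt (fun t => expectationCLM ψ ((flow A t)ᴴ * X * flow A t)) _ θ :=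
    (expectationCLM ψ).hasFDerivAt.comp_hasDerivAt θ ((h1.mul_const X).mul h2)
  simp only [expectation_mulVec]
  refine h3.congr_deriv ?_
  rw [expectationCLM_apply]
  congr 1
  rw [Ring.lie_def]
  simp only [Matrix.mul_assoc, smul_sub, Matrix.mul_sub, Matrix.sub_mul, Matrix.smul_mul,
    Matrix.mul_smul, Matrix.neg_mul, Matrix.mul_neg]
  abel

/-- Taylor's inequality of second order, with a bound on the second derivative. -/
theorem le_quadratic_of_deriv {f f' f'' : ℝ → ℝ} {B : ℝ} (hf : ∀ t, HasDerivAt f (f' t) t)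
    (hf' : ∀ t, HasDerivAt f' (f'' t) t) (hB : ∀ t, f'' t ≤ B) {θ : ℝ} (hθ : 0 ≤ θ) :
    f θ ≤ f 0 + f' 0 * θ + B / 2 * θ ^ 2 := by
  have h1 : ∀ t, 0 ≤ t → f' t ≤ f' 0 + B * t := by
    intro t ht
    have hd : ∀ s, HasDerivAt (fun s => f' s - B * s) (f'' s - B) s := fun s =>
      ((hf' s).sub ((hasDerivAt_id s).const_mul B)).congr_deriv (by ring)
    have := antitone_of_hasDerivAt_nonpos hd (fun s => by simpa using hB s) ht
    simp only [mul_zero, sub_zero] at this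
    linarith
  have hd : ∀ s, HasDerivAt (fun s => f s - f' 0 * s - B / 2 * s ^ 2) (f' s - f' 0 - B * s) s := by
    intro s
    refine (((hf s).sub ((hasDerivAt_id s).const_mul (f' 0))).sub
      (((hasDerivAt_id s).pow 2).const_mul (B / 2))).congr_deriv ?_
    simp only [id]
    ring
  have h2 := antitoneOn_of_deriv_nonpos (convex_Ici 0)
    (fun s _ => (hd s).continuousAt.continuousWithinAt)
    (fun s _ => (hd s).differentiableAt.differentiableWithinAt)
    (fun s hs => by
      rw [(hd s).deriv]
      rw [interior_Ici] at hs
      linarith [h1 s hs.le])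
  have := h2 (Set.mem_Ici.2 le_rfl) (Set.mem_Ici.2 hθ) hθ
  simp only at this
  nlinarith

/-- The second derivative of the energy along the flow is the expectation value of
`i[A, i[A, X]] = -[A, [A, X]]` in a unit vector. -/
theorem expectation_flow_le {A X : QOp n} (hA : A.IsHermitian) {ψ : StateVec n}
    (hψ : star ψ ⬝ᵥ ψ = 1) {θ : ℝ} (hθ : 0 ≤ θ) :
    expectation (flow A θ *ᵥ ψ) X ≤ expectation ψ X + expectation ψ (Complex.I • ⁅A, X⁆) * θ
      + ‖(⁅A, ⁅A, X⁆⁆ : QOp n)‖ / 2 * θ ^ 2 := by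
  have h0 : flow A 0 = 1 := by rw [flow, zero_smul, NormedSpace.exp_zero]
  have h := le_quadratic_of_deriv (B := ‖(⁅A, ⁅A, X⁆⁆ : QOp n)‖)
    (hasDerivAt_expectation_flow hA ψ X)
    (hasDerivAt_expectation_flow hA ψ (Complex.I • ⁅A, X⁆)) (fun t => ?_) hθ
  · simpa only [h0, Matrix.one_mulVec] using h
  · have hnorm : star (flow A t *ᵥ ψ) ⬝ᵥ (flow A t *ᵥ ψ) = 1 := by
      have := star_mulVec_dotProduct (flow A t) 1 ψ
      rwa [Matrix.one_mulVec, Matrix.mul_one, conjTranspose_flow_mul_flow hA, Matrix.one_mulVec,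
        hψ] at this
    refine (le_abs_self _).trans ((abs_expectation_le _ _ hnorm).trans_eq ?_)
    have hI : (⁅A, Complex.I • ⁅A, X⁆⁆ : QOp n) = Complex.I • ⁅A, ⁅A, X⁆⁆ := by
      rw [Ring.lie_def A, Ring.lie_def A (⁅A, X⁆), Matrix.mul_smul, Matrix.smul_mul, smul_sub]
    rw [hI, norm_smul, norm_smul, Complex.norm_I, one_mul, one_mul]

end Flow

/-! ### The slope of the energy at the circuit state -/

section Slope

variable {n : ℕ}

theorem conjTranspose_excitedProj (j : Fin n) : (excitedProj j : QOp n)ᴴ = excitedProj j := by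
  rw [excitedProj, Matrix.diagonal_conjTranspose]
  congr 1
  funext x
  simp only [Pi.star_apply]
  split_ifs <;> simp

theorem isHermitian_opF (W : QOp n) : (opF W).IsHermitian := by
  rw [Matrix.IsHermitian, opF, Matrix.conjTranspose_sum]
  refine Finset.sum_congr rfl fun j _ => ?_
  simp only [Matrix.conjTranspose_mul, Matrix.conjTranspose_conjTranspose,
    conjTranspose_excitedProj, Matrix.mul_assoc]

theorem LocalHamiltonian.isHermitian_op {k : ℕ} (H : LocalHamiltonian n k) :
    H.op.IsHermitian := by
  rw [Matrix.IsHermitian, LocalHamiltonian.op, Matrix.conjTranspose_sum]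
  exact Finset.sum_congr rfl fun R hR => H.isHermitian R hR

theorem isHermitian_opA {H : QOp n} (hH : H.IsHermitian) (W : QOp n) :
    (opA H W).IsHermitian := by
  rw [Matrix.IsHermitian, opA, Matrix.conjTranspose_smul, Matrix.conjTranspose_sub,
    Matrix.conjTranspose_mul, Matrix.conjTranspose_mul, hH.eq, (isHermitian_opF W).eq]
  rw [← neg_sub, smul_neg, Complex.star_def, Complex.conj_I, neg_smul, neg_neg]

theorem deepUnitary_eq_flow (H W : QOp n) (θ : ℝ) : deepUnitary H W θ = flow (opA H W) θ := by
  rw [deepUnitary, flow]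
  congr 1
  rw [← Complex.coe_smul, smul_neg, smul_smul, neg_smul, mul_comm]

/-- In the basis `W|x⟩`, the operator `F` is diagonal and counts the ones of `x`. -/
theorem opF_eq_conj (W : QOp n) :
    opF W = W * Matrix.diagonal
      (fun x : Bits n => ((∑ j, if x j = 1 then 1 else 0 : ℝ) : ℂ)) * Wᴴ := by
  have : (Matrix.diagonal (fun x : Bits n => ((∑ j, if x j = 1 then 1 else 0 : ℝ) : ℂ)) : QOp n)
      = ∑ j, excitedProj j := by
    ext x y
    rw [Matrix.sum_apply]
    by_cases h : x = y
    · subst h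
      simp [excitedProj]
    · simp [excitedProj, h]
  rw [this, opF, Finset.mul_sum, Finset.sum_mul]

variable {W : QOp n}

/-- The circuit state is the ground state of `F`. -/
theorem opF_mulVec (hW : W ∈ Matrix.unitaryGroup (Bits n) ℂ) :
    opF W *ᵥ (W *ᵥ zeroState n) = 0 := by
  have h : Wᴴ * W = 1 := Matrix.mem_unitaryGroup_iff'.1 hW
  rw [opF_eq_conj, Matrix.mulVec_mulVec, Matrix.mul_assoc, h, Matrix.mul_one,
    ← Matrix.mulVec_mulVec, zeroState, Matrix.diagonal_mulVec_single]
  simp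

theorem star_dotProduct_circuitState (hW : W ∈ Matrix.unitaryGroup (Bits n) ℂ) :
    star (W *ᵥ zeroState n) ⬝ᵥ (W *ᵥ zeroState n) = 1 := by
  have h : Wᴴ * W = 1 := Matrix.mem_unitaryGroup_iff'.1 hW
  have := star_mulVec_dotProduct W 1 (zeroState n)
  rw [Matrix.one_mulVec, Matrix.mul_one, h, Matrix.one_mulVec] at this
  rw [this, zeroState]
  simp

theorem im_expectation {H : QOp n} (hH : H.IsHermitian) (ψ : StateVec n) :
    (star ψ ⬝ᵥ (H *ᵥ ψ)).im = 0 := hH.im_star_dotProduct_mulVec_self ψ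

/-- As `F ψ = 0`, the derivative of the energy at `θ = 0` is `-2 ⟨ψ|H F H|ψ⟩`. -/
theorem expectation_lie_opA {H : QOp n} (hW : W ∈ Matrix.unitaryGroup (Bits n) ℂ) :
    expectation (W *ᵥ zeroState n) (Complex.I • ⁅opA H W, H⁆) =
      -2 * expectation (W *ᵥ zeroState n) (H * opF W * H) := by
  set ψ := W *ᵥ zeroState n with hψ
  set F := opF W with hF
  have h0 : F *ᵥ ψ = 0 := opF_mulVec hW
  have h0' : star ψ ᵥ* F = 0 := by
    have hF' : Fᴴ = F := isHermitian_opF W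
    rw [← hF', ← Matrix.star_mulVec, h0, star_zero]
  have hX : Complex.I • (⁅opA H W, H⁆ : QOp n) =
      F * (H * H) + H * H * F - (2 : ℂ) • (H * F * H) := by
    have hI : Complex.I * Complex.I = -1 := Complex.I_mul_I
    rw [Ring.lie_def, opA, ← hF]
    simp only [Matrix.smul_mul, Matrix.mul_smul, ← smul_sub, smul_smul, hI, two_smul, neg_smul,
      one_smul, Matrix.sub_mul, Matrix.mul_sub, Matrix.mul_assoc]
    abel
  have h1 : star ψ ⬝ᵥ ((F * (H * H)) *ᵥ ψ) = 0 := by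
    rw [← Matrix.mulVec_mulVec, Matrix.dotProduct_mulVec, h0', zero_dotProduct]
  have h2 : (H * H * F) *ᵥ ψ = 0 := by rw [← Matrix.mulVec_mulVec, h0, Matrix.mulVec_zero]
  rw [hX, expectation, expectation, Matrix.sub_mulVec, Matrix.add_mulVec, dotProduct_sub,
    dotProduct_add, h1, h2, Matrix.smul_mulVec, dotProduct_smul, dotProduct_zero]
  simp

/-- In the basis `W|x⟩` both sides are read off from the amplitudes `φ x` of `H ψ`: the variance
is `∑_{x ≠ 0} |φ x|²`, and `F` multiplies `|φ x|²` by the number of ones in `x`, which is at least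
`1` for `x ≠ 0`. -/
theorem variance_le_expectation_opF {H : QOp n} (hH : H.IsHermitian)
    (hW : W ∈ Matrix.unitaryGroup (Bits n) ℂ) :
    0 ≤ variance (W *ᵥ zeroState n) H ∧
    variance (W *ᵥ zeroState n) H ≤ expectation (W *ᵥ zeroState n) (H * opF W * H) := by
  have hWW : W * Wᴴ = 1 := Matrix.mem_unitaryGroup_iff.1 hW
  set ψ := W *ᵥ zeroState n with hψ
  set φ : StateVec n := Wᴴ *ᵥ (H *ᵥ ψ) with hφ
  have hsum : ∀ v : Bits n → ℝ,
      expectation φ (Matrix.diagonal fun x => (v x : ℂ)) = ∑ x, v x * Complex.normSq (φ x) := by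
    intro v
    rw [expectation, dotProduct, Complex.re_sum]
    refine Finset.sum_congr rfl fun x _ => ?_
    rw [Matrix.mulVec_diagonal, Pi.star_apply, mul_left_comm, Complex.star_def,
      ← Complex.normSq_eq_conj_mul_self, ← Complex.ofReal_mul, Complex.ofReal_re]
  have hconj : ∀ D : QOp n, expectation φ D = expectation ψ (H * (W * D * Wᴴ) * H) := by
    intro D
    rw [hφ, expectation_mulVec, expectation_mulVec, hH.eq, Matrix.conjTranspose_conjTranspose]
  have hF : expectation ψ (H * opF W * H) =
      ∑ x, (∑ j, if x j = 1 then 1 else 0 : ℝ) * Complex.normSq (φ x) := by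
    rw [opF_eq_conj, ← hconj, hsum]
  have hHH : expectation ψ (H * H) = ∑ x, Complex.normSq (φ x) := by
    have := hsum fun _ => 1
    simp only [one_mul] at this
    rw [← this, hconj]
    simp [hWW]
  have hE : expectation ψ H ^ 2 = Complex.normSq (φ 0) := by
    have h0 : φ 0 = star ψ ⬝ᵥ (H *ᵥ ψ) := by
      have : φ 0 = star (zeroState n) ⬝ᵥ φ := by
        rw [zeroState, ← Pi.single_star, star_one, single_one_dotProduct]
        rfl
      rw [this, hφ, hψ, Matrix.star_mulVec, ← Matrix.dotProduct_mulVec]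
    rw [h0, Complex.normSq_apply, im_expectation hH, expectation]
    ring
  have hvar : variance ψ H = ∑ x ∈ Finset.univ.erase 0, Complex.normSq (φ x) := by
    rw [variance, hHH, hE, ← Finset.add_sum_erase _ _ (Finset.mem_univ (0 : Bits n))]
    ring
  rw [hvar, hF]
  refine ⟨Finset.sum_nonneg fun x _ => Complex.normSq_nonneg _, ?_⟩
  rw [← Finset.add_sum_erase _ _ (Finset.mem_univ (0 : Bits n))]
  refine le_add_of_nonneg_of_le (by simp) (Finset.sum_le_sum fun x hx => ?_)
  obtain ⟨i, hi⟩ := Function.ne_iff.1 (Finset.ne_of_mem_erase hx)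
  refine le_mul_of_one_le_left (Complex.normSq_nonneg _) ?_
  have hi1 : x i = 1 := by
    simp only [Pi.zero_apply] at hi
    omega
  have := Finset.single_le_sum (f := fun j => if x j = 1 then (1 : ℝ) else 0)
    (fun j _ => by positivity) (Finset.mem_univ i)
  simpa [hi1] using this

end Slope

/-! ### The decrease of the energy -/

theorem theorem2 :
    ∃ C : ℝ, 0 < C ∧
      ∀ (n k : ℕ) (H : LocalHamiltonian n k) (W : Circuit n),
        ∃ θ : ℝ,
          expectation (deepUnitary H.op W.toOp θ *ᵥ (W.toOp *ᵥ zeroState n)) H.op ≤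
            expectation (W.toOp *ᵥ zeroState n) H.op -
              C * (variance (W.toOp *ᵥ zeroState n) H.op ^ 2 /
                ((k : ℝ) ^ 4 * (W.maxLightcone : ℝ) ^ 10 * (H.maxDegree : ℝ) ^ 2 *
                  (H.edges.card : ℝ))) := by
  refine ⟨1 / 96, by norm_num, fun n k H W => ?_⟩
  have hW := W.toOp_mem_unitaryGroup
  set V := variance (W.toOp *ᵥ zeroState n) H.op with hV
  obtain ⟨hV0, hVF⟩ := variance_le_expectation_opF H.isHermitian_op hW
  rw [← hV] at hV0 hVF
  set D : ℝ := (k : ℝ) ^ 4 * (W.maxLightcone : ℝ) ^ 10 * (H.maxDegree : ℝ) ^ 2 *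
    (H.edges.card : ℝ) with hD
  have hD0 : 0 ≤ D := by positivity
  rcases hD0.eq_or_lt with hD0 | hD0
  · -- A vanishing denominator makes the claimed decrease `0`, by the convention `x / 0 = 0`.
    refine ⟨0, le_of_eq ?_⟩
    rw [← hD0, deepUnitary_eq_flow, flow, zero_smul, NormedSpace.exp_zero, Matrix.one_mulVec,
      div_zero, mul_zero, sub_zero]
  have hk : 1 ≤ k := Nat.one_le_iff_ne_zero.2 fun h => by simp [hD, h] at hD0
  have hl : 1 ≤ W.maxLightcone := Nat.one_le_iff_ne_zero.2 fun h => by simp [hD, h] at hD0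
  -- This `θ` minimises the quadratic upper bound `-2 V θ + 96 D θ²` for the change of energy.
  refine ⟨V / (96 * D), ?_⟩
  have hθ : 0 ≤ V / (96 * D) := by positivity
  have hB := norm_lie_lie_op_le H W hk hl
  have h := expectation_flow_le (X := H.op) (isHermitian_opA H.isHermitian_op W.toOp)
    (star_dotProduct_circuitState hW) hθ
  rw [expectation_lie_opA hW] at h
  rw [deepUnitary_eq_flow]
  refine h.trans ?_
  have h1 : -2 * expectation (W.toOp *ᵥ zeroState n) (H.op * opF W.toOp * H.op) * (V / (96 * D)) ≤
      -2 * V * (V / (96 * D)) := mul_le_mul_of_nonneg_right (by linarith) hθ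
  have h2 := mul_le_mul_of_nonneg_right (div_le_div_of_nonneg_right hB zero_le_two)
    (sq_nonneg (V / (96 * D)))
  have h3 : -2 * V * (V / (96 * D)) + 192 * D / 2 * (V / (96 * D)) ^ 2 =
      -(1 / 96 * (V ^ 2 / D)) := by
    field_simp
    ring
  rw [← hD] at h2
  linarith
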